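/- Let $C_{00}(\mathbb R)$ be the real vector space of continuous functions $f:\mathbb R\to\mathbb R$ whose support is compact, equipped with the norm $\|f\|_\infty:=\sup\{|f(x)|: x\in\mathbb R\}$, let $X^*$ be the normed dual of the normed space $X:=(C_{00}(\mathbb R),\|\cdot\|_\infty)$, and let $C:=\{f\in C_{00}(\mathbb R): f(x)\ge 0\ \text{for all } x\in\mathbb R\}$ be its positive cone. Then: (a) $X$ is not complete; (b) the dual cone $C^*:=\{\varphi\in X^*: \varphi(f)\ge 0\ \text{for all } f\in C\}$ is quasi-generating, that is, $C^*-C^*$ is norm dense in $X^*$; (c) $0$ is not a point of continuity for $C$, that is, the identity map from $C$ with the (relative) weak topology of $X$ to $C$ with the norm topology is not continuous at $0$. -/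

import Mathlib

open scoped BoundedContinuousFunction CompactlySupported Pointwise

noncomputable section

/-- The real vector space of continuous functions `ℝ → ℝ` with compact support. -/
abbrev C00 : Type := C_c(ℝ, ℝ)

/-- The inclusion of `C00` in the bounded continuous functions. -/
def C00.toBCF : C00 →ₗ[ℝ] (ℝ →ᵇ ℝ) where
  toFun f := (f : ℝ →ᵇ ℝ)
  map_add' _ _ := rfl
  map_smul' _ _ := rfl

theorem C00.toBCF_injective : Function.Injective C00.toBCF :=
  fun _ _ h => DFunLike.ext _ _ fun x => DFunLike.congr_fun h x

/-- `C00` carries the supremum norm, see `C00.norm_eq`. -/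
instance C00.instNormedAddCommGroup : NormedAddCommGroup C00 :=
  NormedAddCommGroup.induced C00 (ℝ →ᵇ ℝ) C00.toBCF C00.toBCF_injective

instance C00.instNormedSpace : NormedSpace ℝ C00 :=
  NormedSpace.induced ℝ C00 (ℝ →ᵇ ℝ) C00.toBCF

theorem C00.norm_eq (f : C00) : ‖f‖ = ⨆ x : ℝ, |f x| :=
  (C00.toBCF f).norm_eq_iSup_norm

/-- The order cone of the pointwise nonnegative functions in `C00`. -/
def C00.positiveCone : PointedCone ℝ C00 where
  carrier := {f | ∀ x : ℝ, 0 ≤ f x}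
  zero_mem' := fun _ => le_rfl
  add_mem' := fun hf hg x => add_nonneg (hf x) (hg x)
  smul_mem' := fun c _ hf x => mul_nonneg c.2 (hf x)

section Cones

variable {X : Type*} [NormedAddCommGroup X] [NormedSpace ℝ X]

/-- The dual cone `{f ∈ X* | ∀ c ∈ C, 0 ≤ f c}`, in the normed dual of `X`. -/
def dualCone (C : PointedCone ℝ X) : PointedCone ℝ (StrongDual ℝ X) :=
  PointedCone.dual (topDualPairing ℝ X).flip (C : Set X)

theorem mem_dualCone {C : PointedCone ℝ X} {f : StrongDual ℝ X} :
    f ∈ dualCone C ↔ ∀ c ∈ C, 0 ≤ f c :=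
  Iff.rfl

/-- A cone is quasi-generating if the differences of its elements are norm dense. -/
def IsQuasiGenerating (C : PointedCone ℝ X) : Prop :=
  closure ((C : Set X) - (C : Set X)) = Set.univ

/-- `x ∈ A` is a point of continuity for `A` if the identity map from `A` with the weak topology
to `A` with the norm topology is continuous at `x`. -/
def IsPointOfContinuity (A : Set X) (x : A) : Prop :=
  ContinuousWithinAt (toWeakSpace ℝ X).symm (toWeakSpace ℝ X '' A) (toWeakSpace ℝ X x)

end Cones

end

open Filter Topology

namespace C00

/-! Incompleteness: compactly supported truncations of `1 / (1 + |x|)` are Cauchy, but their limit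
vanishes nowhere. Density holds with equality, `C* - C* = X*`, by a Hahn–Banach extension to `C00 ×
C00` (`exists_eq_sub_of_mem_dualCone`). This decomposition also gives the last claim. The increments
of the increasing sequence `plateau n` lie in the cone and have norm at least `1`, yet a positive
functional is monotone and bounded along `plateau n`, so it sends the increments to `0`. By the
decomposition every functional does, so they are weakly null. -/

theorem abs_apply_le_norm (f : C00) (x : ℝ) : |f x| ≤ ‖f‖ :=
  (toBCF f).norm_coe_le_norm x

theorem norm_le_of_forall_abs_le {f : C00} {r : ℝ} (h : ∀ x, |f x| ≤ r) : ‖f‖ ≤ r := by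
  rw [norm_eq]
  exact ciSup_le h

/-- The element of `C00` given by a continuous function `g` that vanishes outside `[-r, r]`. -/
noncomputable def ofVanishing (g : ℝ → ℝ) (hg : Continuous g) (r : ℝ)
    (h : ∀ x, r < |x| → g x = 0) : C00 where
  toFun := g
  continuous_toFun := hg
  hasCompactSupport' := by
    refine HasCompactSupport.intro (isCompact_closedBall (0 : ℝ) r) fun x hx => h x ?_
    simpa using hx

/-! ### Incompleteness -/

/-- The positive function `1 / (1 + |x|)`, lowered by `1 / (n + 1)` and truncated at `0`. -/
noncomputable def truncation (n : ℕ) : C00 :=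
  ofVanishing (fun x => max (1 / (1 + |x|) - 1 / ((n : ℝ) + 1)) 0)
    ((((continuous_const.div (continuous_const.add continuous_abs)
      fun x => (add_pos_of_pos_of_nonneg one_pos (abs_nonneg x)).ne')).sub continuous_const).max continuous_const) n
    fun x hx => max_eq_right <| sub_nonpos.2 <|
      one_div_le_one_div_of_le (by positivity) (by linarith)

theorem truncation_apply (n : ℕ) (x : ℝ) :
    truncation n x = max (1 / (1 + |x|) - 1 / ((n : ℝ) + 1)) 0 :=
  rfl

theorem cauchySeq_truncation : CauchySeq truncation := by
  refine cauchySeq_of_le_tendsto_0 (fun N : ℕ => 1 / ((N : ℝ) + 1)) (fun n m N hn hm => ?_)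
    tendsto_one_div_add_atTop_nhds_zero_nat
  rw [dist_eq_norm]
  refine norm_le_of_forall_abs_le fun x => ?_
  change |truncation n x - truncation m x| ≤ _
  rw [truncation_apply, truncation_apply]
  refine (abs_max_sub_max_le_abs _ _ _).trans ?_
  have bound : ∀ k : ℕ, N ≤ k → 0 ≤ 1 / ((k : ℝ) + 1) ∧ 1 / ((k : ℝ) + 1) ≤ 1 / ((N : ℝ) + 1) :=
    fun k hk => ⟨by positivity, Nat.one_div_le_one_div hk⟩
  obtain ⟨hn₀, hn₁⟩ := bound n hn
  obtain ⟨hm₀, hm₁⟩ := bound m hm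
  exact abs_le.2 ⟨by linarith, by linarith⟩

theorem tendsto_apply {u : ℕ → C00} {f : C00} (h : Tendsto u atTop (𝓝 f)) (x : ℝ) :
    Tendsto (fun n => u n x) atTop (𝓝 (f x)) := by
  rw [tendsto_iff_norm_sub_tendsto_zero] at h ⊢
  exact squeeze_zero (fun _ => norm_nonneg _) (fun n => abs_apply_le_norm (u n - f) x) h

theorem not_completeSpace : ¬ CompleteSpace C00 := by
  intro _
  obtain ⟨f, hf⟩ := cauchySeq_tendsto_of_complete cauchySeq_truncation
  have hfx : ∀ x, f x ≠ 0 := fun x => by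
    have pos : (0 : ℝ) < 1 / (1 + |x|) := by positivity
    have lim : Tendsto (fun n => truncation n x) atTop (𝓝 (max (1 / (1 + |x|) - 0) 0)) :=
      (tendsto_const_nhds.sub tendsto_one_div_add_atTop_nhds_zero_nat).max tendsto_const_nhds
    rw [tendsto_nhds_unique (tendsto_apply hf x) lim, sub_zero, max_eq_left pos.le]
    exact pos.ne'
  have hsupp : tsupport f = Set.univ :=
    Set.univ_subset_iff.1 fun x _ => subset_tsupport f (hfx x)
  exact noncompact_univ ℝ (hsupp ▸ f.hasCompactSupport)

/-! ### The dual cone is generating -/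

theorem bddAbove_range (f : C00) : BddAbove (Set.range f) :=
  ⟨‖f‖, by rintro _ ⟨x, rfl⟩; exact (le_abs_self _).trans (abs_apply_le_norm f x)⟩

theorem iSup_add_le (f g : C00) : ⨆ x, (f + g) x ≤ (⨆ x, f x) + ⨆ x, g x :=
  ciSup_le fun x => add_le_add (le_ciSup f.bddAbove_range x) (le_ciSup g.bddAbove_range x)

theorem iSup_smul {c : ℝ} (hc : 0 ≤ c) (f : C00) : ⨆ x, (c • f) x = c * ⨆ x, f x :=
  (Real.mul_iSup_of_nonneg hc _).symm

theorem iSup_le_norm (f : C00) : ⨆ x, f x ≤ ‖f‖ :=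
  ciSup_le fun x => (le_abs_self _).trans (abs_apply_le_norm f x)

theorem norm_le_max_iSup (f : C00) : ‖f‖ ≤ max (⨆ x, f x) (⨆ x, (-f) x) :=
  norm_le_of_forall_abs_le fun x =>
    max_le_max (le_ciSup f.bddAbove_range x) (le_ciSup (-f).bddAbove_range x)

/-- Every bounded functional on `C00` is a difference of two positive ones: extend
`(f, -f) ↦ φ f` to `C00 × C00`, dominated by `(f, g) ↦ ‖φ‖ * max (sup f) (sup g)`. -/
theorem exists_eq_sub_of_mem_dualCone (φ : StrongDual ℝ C00) :
    ∃ ψ₁ ∈ dualCone positiveCone, ∃ ψ₂ ∈ dualCone positiveCone, φ = ψ₁ - ψ₂ := by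
  -- One-sided suprema, not norms: `N` is nonpositive on pairs of nonpositive functions, which
  -- forces the extension to be positive.
  let N : C00 × C00 → ℝ := fun p => ‖φ‖ * max (⨆ x, p.1 x) (⨆ x, p.2 x)
  let D : Submodule ℝ (C00 × C00) :=
    LinearMap.ker (LinearMap.fst ℝ C00 C00 + LinearMap.snd ℝ C00 C00)
  let φD : C00 × C00 →ₗ.[ℝ] ℝ :=
    ⟨D, ((φ : C00 →ₗ[ℝ] ℝ).comp (LinearMap.fst ℝ C00 C00)).domRestrict D⟩
  obtain ⟨Λ, hΛ, hΛN⟩ := exists_extension_of_le_sublinear φD N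
    (fun c hc p => by
      change ‖φ‖ * max (⨆ x, (c • p.1) x) (⨆ x, (c • p.2) x) = c * (‖φ‖ * _)
      rw [iSup_smul hc.le, iSup_smul hc.le, ← mul_max_of_nonneg _ _ hc.le, mul_left_comm])
    (fun p q => by
      change ‖φ‖ * max (⨆ x, (p.1 + q.1) x) (⨆ x, (p.2 + q.2) x) ≤ ‖φ‖ * _ + ‖φ‖ * _
      rw [← mul_add]
      exact mul_le_mul_of_nonneg_left
        (max_le ((iSup_add_le _ _).trans (add_le_add (le_max_left _ _) (le_max_left _ _)))
          ((iSup_add_le _ _).trans (add_le_add (le_max_right _ _) (le_max_right _ _))))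
        (norm_nonneg φ))
    (by
      rintro ⟨⟨f, g⟩, hfg⟩
      obtain rfl : g = -f := (neg_eq_of_add_eq_zero_right hfg).symm
      exact (le_abs_self (φ f)).trans ((φ.le_opNorm f).trans
        (mul_le_mul_of_nonneg_left (norm_le_max_iSup f) (norm_nonneg φ))))
  have hle : ∀ f g : C00, Λ (f, g) ≤ ‖φ‖ * max ‖f‖ ‖g‖ := fun f g => (hΛN _).trans <|
    mul_le_mul_of_nonneg_left (max_le_max (iSup_le_norm f) (iSup_le_norm g)) (norm_nonneg φ)
  have habs : ∀ f g : C00, ‖Λ (f, g)‖ ≤ ‖φ‖ * max ‖f‖ ‖g‖ := fun f g => by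
    refine abs_le'.2 ⟨hle f g, ?_⟩
    rw [← map_neg]
    simpa using hle (-f) (-g)
  have hpos : ∀ f g : C00, (∀ x, 0 ≤ f x) → (∀ x, 0 ≤ g x) → 0 ≤ Λ (f, g) := fun f g hf hg => by
    have h : Λ (-(f, g)) ≤ 0 := (hΛN _).trans <|
      mul_nonpos_of_nonneg_of_nonpos (norm_nonneg φ) <|
        max_le (ciSup_le fun x => neg_nonpos.2 (hf x)) (ciSup_le fun x => neg_nonpos.2 (hg x))
    rw [map_neg] at h
    linarith
  let ψ₁ : StrongDual ℝ C00 := (Λ.comp (LinearMap.inl ℝ C00 C00)).mkContinuous ‖φ‖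
    fun f => by simpa using habs f 0
  let ψ₂ : StrongDual ℝ C00 := (Λ.comp (LinearMap.inr ℝ C00 C00)).mkContinuous ‖φ‖
    fun f => by simpa using habs 0 f
  refine ⟨ψ₁, mem_dualCone.2 fun f hf => hpos f 0 hf fun _ => le_rfl,
    ψ₂, mem_dualCone.2 fun f hf => hpos 0 f (fun _ => le_rfl) hf, ?_⟩
  ext f
  -- Splitting `(f, -f) = (f, 0) - (0, f)` turns the prescribed value into a difference of the two
  -- restrictions.
  have hf : Λ (f, -f) = φ f := hΛ ⟨(f, -f), add_neg_cancel f⟩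
  change φ f = Λ (f, 0) - Λ (0, f)
  rw [← hf, ← map_sub]
  simp

theorem isQuasiGenerating_dualCone : IsQuasiGenerating (dualCone positiveCone) := by
  refine Set.univ_subset_iff.1 fun φ _ => subset_closure ?_
  obtain ⟨ψ₁, h₁, ψ₂, h₂, rfl⟩ := exists_eq_sub_of_mem_dualCone φ
  exact Set.sub_mem_sub h₁ h₂

/-! ### The origin is not a point of continuity -/

/-- The trapezoid function equal to `1` on `[1 - n, n - 1]` and to `0` outside `[-n, n]`. -/
noncomputable def plateau (n : ℕ) : C00 :=
  ofVanishing (fun x => min 1 (max 0 ((n : ℝ) - |x|)))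
    (continuous_const.min (continuous_const.max (continuous_const.sub continuous_abs))) n
    fun x hx => by rw [max_eq_left (by linarith), min_eq_right zero_le_one]

theorem plateau_apply (n : ℕ) (x : ℝ) : plateau n x = min 1 (max 0 ((n : ℝ) - |x|)) :=
  rfl

theorem norm_plateau_le (n : ℕ) : ‖plateau n‖ ≤ 1 :=
  norm_le_of_forall_abs_le fun x => by
    rw [plateau_apply, abs_of_nonneg (le_min zero_le_one (le_max_left _ _))]
    exact min_le_left _ _

theorem plateau_succ_sub_mem (n : ℕ) : plateau (n + 1) - plateau n ∈ positiveCone := fun x => by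
  change 0 ≤ plateau (n + 1) x - plateau n x
  rw [plateau_apply, plateau_apply, sub_nonneg]
  gcongr
  exact n.le_succ

theorem one_le_norm_plateau_succ_sub (n : ℕ) : 1 ≤ ‖plateau (n + 1) - plateau n‖ := by
  -- At the point `n` the larger plateau is still `1` and the smaller is already `0`.
  refine le_trans ?_ (abs_apply_le_norm _ (n : ℝ))
  change 1 ≤ |plateau (n + 1) n - plateau n n|
  simp [plateau_apply]

theorem tendsto_apply_plateau_succ_sub_of_mem {ψ : StrongDual ℝ C00}
    (hψ : ψ ∈ dualCone positiveCone) :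
    Tendsto (fun n => ψ (plateau (n + 1) - plateau n)) atTop (𝓝 0) := by
  have mono : Monotone fun n => ψ (plateau n) := monotone_nat_of_le_succ fun n => by
    have := mem_dualCone.1 hψ _ (plateau_succ_sub_mem n)
    rwa [map_sub, sub_nonneg] at this
  have bdd : BddAbove (Set.range fun n => ψ (plateau n)) := by
    refine ⟨‖ψ‖, ?_⟩
    rintro _ ⟨n, rfl⟩
    exact (le_abs_self _).trans (ψ.le_of_opNorm_le_of_le le_rfl (norm_plateau_le n) |>.trans_eq
      (mul_one _))
  have lim := tendsto_atTop_ciSup mono bdd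
  simpa using (lim.comp (tendsto_add_atTop_nat 1)).sub lim

theorem tendsto_apply_plateau_succ_sub (φ : StrongDual ℝ C00) :
    Tendsto (fun n => φ (plateau (n + 1) - plateau n)) atTop (𝓝 0) := by
  obtain ⟨ψ₁, h₁, ψ₂, h₂, rfl⟩ := exists_eq_sub_of_mem_dualCone φ
  simpa using (tendsto_apply_plateau_succ_sub_of_mem h₁).sub
    (tendsto_apply_plateau_succ_sub_of_mem h₂)

theorem tendsto_toWeakSpace_plateau_succ_sub :
    Tendsto (fun n => toWeakSpace ℝ C00 (plateau (n + 1) - plateau n)) atTop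
      (𝓝 (toWeakSpace ℝ C00 0)) := by
  -- The weak topology is by definition induced by all evaluations, so convergence is tested on each
  -- functional.
  have ind : IsInducing fun (f : WeakSpace ℝ C00) (φ : StrongDual ℝ C00) =>
      φ ((toWeakSpace ℝ C00).symm f) := ⟨rfl⟩
  refine ind.tendsto_nhds_iff.2 (tendsto_pi_nhds.2 fun φ => ?_)
  change Tendsto (fun n => φ (plateau (n + 1) - plateau n)) atTop (𝓝 (φ 0))
  rw [map_zero]
  exact tendsto_apply_plateau_succ_sub φ

theorem not_isPointOfContinuity_zero :
    ¬ IsPointOfContinuity (positiveCone : Set C00) ⟨0, positiveCone.zero_mem⟩ := by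
  intro h
  have lim : Tendsto (fun n => plateau (n + 1) - plateau n) atTop (𝓝 0) :=
    Tendsto.comp h (tendsto_nhdsWithin_iff.2 ⟨tendsto_toWeakSpace_plateau_succ_sub,
      Eventually.of_forall fun n => Set.mem_image_of_mem _ (plateau_succ_sub_mem n)⟩)
  have := ge_of_tendsto' lim.norm one_le_norm_plateau_succ_sub
  rw [norm_zero] at this
  exact absurd this (by norm_num)

end C00

theorem mainTheorem11 :
    ¬ CompleteSpace C00 ∧
    IsQuasiGenerating (dualCone C00.positiveCone) ∧
    ¬ IsPointOfContinuity (C00.positiveCone : Set C00) ⟨0, C00.positiveCone.zero_mem⟩ :=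
  ⟨C00.not_completeSpace, C00.isQuasiGenerating_dualCone, C00.not_isPointOfContinuity_zero⟩
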